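/- Let $\Gamma$ be a finite multigraph without loops (parallel edges are allowed; $\Gamma$ need not be connected), with $n\ge 1$ vertices numbered $1,\dots,n$ in an arbitrary way. Let $A_\Gamma$ be its adjacency matrix, that is, the $n\times n$ matrix whose $(i,j)$ entry is the number of edges joining vertices $i$ and $j$; let $D_\Gamma$ be the diagonal matrix of vertex degrees; and let the Kirchhoff minor $K_\Gamma$ be the $(n-1)\times(n-1)$ matrix obtained from $D_\Gamma-A_\Gamma$ by deleting the last row and the last column. Let $\tau(\Gamma)$ be the number of spanning trees of $\Gamma$, i.e. of subgraphs of $\Gamma$ that contain all its vertices, are connected and have no cycles (parallel edges are regarded as distinct). Then \[\tau(\Gamma)=\det K_\Gamma ,\] where for $n=1$ the determinant of the empty matrix is $1$. -/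

import Mathlib

namespace Graph

/-- From every vertex one can walk along edges to every other vertex; the graph has a vertex. -/
def IsConnectedGraph {α β : Type*} (G : Graph α β) : Prop :=
  G.vertexSet.Nonempty ∧
    ∀ x ∈ G.vertexSet, ∀ y ∈ G.vertexSet, Relation.ReflTransGen G.Adj x y

/-- `G.IsCycleOn x e` says that `x 0, e 0, x 1, e 1, …, x k, e k, x 0` is a cycle of length `k + 1`:
the vertices are pairwise distinct, the edges are pairwise distinct, and `e i` joins `x i` to its
cyclic successor (addition in `Fin (k + 1)` wraps around). A loop is a cycle of length one, and two
parallel edges form a cycle of length two. -/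
def IsCycleOn {α β : Type*} (G : Graph α β) {k : ℕ}
    (x : Fin (k + 1) → α) (e : Fin (k + 1) → β) : Prop :=
  Function.Injective x ∧ Function.Injective e ∧ ∀ i, G.IsLink (e i) (x i) (x (i + 1))

/-- A tree is a connected graph without cycles. -/
def IsTreeGraph {α β : Type*} (G : Graph α β) : Prop :=
  G.IsConnectedGraph ∧
    ∀ (k : ℕ) (x : Fin (k + 1) → α) (e : Fin (k + 1) → β), ¬ G.IsCycleOn x e

/-- The set of spanning trees of `G`: subgraphs on all the vertices of `G` that are trees. -/
def spanningTrees {α β : Type*} (G : Graph α β) : Set (Graph α β) :=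
  {T | T.IsSpanningSubgraph G ∧ T.IsTreeGraph}

/-- The number of spanning trees (meaningful if the edge set is finite). -/
noncomputable def numSpanningTrees {α β : Type*} (G : Graph α β) : ℕ :=
  G.spanningTrees.ncard

/-- The degree of a vertex: the number of edges at it, loops counted twice. -/
noncomputable def vertexDegree {α β : Type*} (G : Graph α β) (x : α) : ℕ :=
  (G.incidenceSet x).ncard + (G.loopSet x).ncard

/-- The adjacency matrix for a list `v` of vertices: entry `(i, j)` is the number of edges that
join `v i` and `v j`. -/
noncomputable def adjacencyMatrix {α β : Type*} (G : Graph α β) {n : ℕ}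
    (v : Fin n → α) : Matrix (Fin n) (Fin n) ℤ :=
  Matrix.of fun i j => (({e | G.IsLink e (v i) (v j)} : Set β).ncard : ℤ)

/-- The degree matrix minus the adjacency matrix. -/
noncomputable def laplacianMatrix {α β : Type*} (G : Graph α β) {n : ℕ}
    (v : Fin n → α) : Matrix (Fin n) (Fin n) ℤ :=
  Matrix.diagonal (fun i => (G.vertexDegree (v i) : ℤ)) - G.adjacencyMatrix v

/-- The Kirchhoff minor: the Laplacian with its last row and last column removed. -/
noncomputable def kirchhoffMinor {α β : Type*} (G : Graph α β) {n : ℕ}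
    (v : Fin (n + 1) → α) : Matrix (Fin n) (Fin n) ℤ :=
  (G.laplacianMatrix v).submatrix Fin.castSucc Fin.castSucc

end Graph

open Relation

namespace Matrix

/-! Row `i` of the Kirchhoff minor is the sum, over the edges at vertex `i`, of the basis row of `i`
minus that of the other end (zero if that end is the last vertex). By multilinearity the determinant
is a sum over choices `f` of one edge per non-last vertex (`kirchhoffMinor_eq_sum_edgeRow`). If each
edge is incident to its vertex, the term is `det (1 - P)`, where `p` moves along the chosen edges: 1
if every orbit reaches the last vertex, 0 otherwise (`det_edgeRow`). Choices of the first kind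
correspond to spanning trees: the tree is `Set.range f`, and `f` is recovered by directing its edges
towards the root. -/

/-- If the map `i ↦ p i` strictly decreases some height function, the matrix `1 - P`, where `P` is
the 0-1 matrix of `p` with the column of the last element removed, is triangular with unit diagonal. -/
theorem det_one_sub_of_height {n : ℕ} (p : Fin n → Fin (n + 1)) (d : Fin (n + 1) → ℕ)
    (hd : ∀ i, d (p i) < d i.castSucc) :
    (Matrix.of fun i j : Fin n =>
      (if i = j then (1 : ℤ) else 0) - if p i = j.castSucc then 1 else 0).det = 1 := by
  -- `P` leads to smaller heights, so the transpose is upper triangular for the height order; blocks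
  -- are needed since heights may repeat.
  rw [← det_transpose]
  set M := (Matrix.of fun i j : Fin n =>
      (if i = j then (1 : ℤ) else 0) - if p i = j.castSucc then 1 else 0)ᵀ with hM
  have htri : M.BlockTriangular fun i : Fin n => d i.castSucc := by
    intro i j hij
    have h1 : j ≠ i := by rintro rfl; exact lt_irrefl _ hij
    have h2 : p j ≠ i.castSucc := fun h => by
      have := hd j
      rw [h] at this
      exact lt_asymm hij this
    simp [hM, h1, h2]
  rw [htri.det]
  refine Finset.prod_eq_one fun a _ => ?_
  have : M.toSquareBlock (fun i : Fin n => d i.castSucc) a = 1 := by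
    ext ⟨i, hi⟩ ⟨j, hj⟩
    have h2 : p j ≠ i.castSucc := fun h => by
      have := hd j
      rw [h] at this
      omega
    simp [hM, toSquareBlock_def, h2, Matrix.one_apply, eq_comm]
  rw [this, det_one]

/-- If no height function decreases along `p`, the indicator of the elements whose `p`-orbit
avoids the last element lies in the kernel of `1 - P`. -/
theorem det_one_sub_of_no_height {n : ℕ} (p : Fin n → Fin (n + 1))
    (hp : ¬ ∃ d : Fin (n + 1) → ℕ, ∀ i, d (p i) < d i.castSucc) :
    (Matrix.of fun i j : Fin n =>
      (if i = j then (1 : ℤ) else 0) - if p i = j.castSucc then 1 else 0).det = 0 := by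
  classical
  -- Making the last element a fixed point turns `p` into a self-map that can be iterated.
  let q : Fin (n + 1) → Fin (n + 1) := Fin.lastCases (Fin.last n) p
  have hq (i : Fin n) : q i.castSucc = p i := by simp [q]
  have hql : q (Fin.last n) = Fin.last n := by simp [q]
  let R : Fin (n + 1) → Prop := fun i => ∃ m, q^[m] i = Fin.last n
  have hRl : R (Fin.last n) := ⟨0, rfl⟩
  have hRq (i : Fin n) : R (p i) ↔ R i.castSucc := by
    rw [← hq]
    constructor
    · rintro ⟨m, hm⟩
      exact ⟨m + 1, by rwa [Function.iterate_succ_apply]⟩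
    · rintro ⟨m, hm⟩
      refine ⟨m, ?_⟩
      rw [← Function.iterate_succ_apply, Function.iterate_succ_apply', hm, hql]
  have hbad : ∃ i : Fin n, ¬ R i.castSucc := by
    -- Otherwise the number of steps to the last element would be a height.
    by_contra! hall
    have hR : ∀ i, R i := Fin.lastCases hRl hall
    refine hp ⟨fun i => Nat.find (hR i), fun i => ?_⟩
    have hs := Nat.find_spec (hR i.castSucc)
    rcases hm : Nat.find (hR i.castSucc) with _ | m
    · rw [hm] at hs
      exact absurd hs (Fin.castSucc_lt_last i).ne
    · rw [hm, Function.iterate_succ_apply, hq] at hs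
      simp only [hm]
      exact Nat.lt_succ_of_le (Nat.find_min' (hR (p i)) hs)
  refine exists_mulVec_eq_zero_iff.mp
    ⟨fun i => if R i.castSucc then 0 else 1, fun h => ?_, ?_⟩
  · obtain ⟨i, hi⟩ := hbad
    simpa [hi] using congrFun h i
  · ext i
    have hsum : (∑ j : Fin n, (if p i = j.castSucc then (1 : ℤ) else 0) *
        if R j.castSucc then 0 else 1) = if R (p i) then 0 else 1 := by
      induction h : p i using Fin.lastCases with
      | last => simp [hRl, (Fin.castSucc_lt_last _).ne']
      | cast k => simp only [Fin.castSucc_inj, ite_mul, one_mul, zero_mul, Finset.sum_ite_eq,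
          Finset.mem_univ, if_true]
    simp only [mulVec, dotProduct, of_apply, sub_mul, Finset.sum_sub_distrib, hsum, hRq]
    simp only [ite_mul, one_mul, zero_mul, Finset.sum_ite_eq, Finset.mem_univ, if_true, sub_self, Pi.zero_apply]

end Matrix

namespace Graph

/-- Gives access to simple paths and distances. -/
theorem reachable_fromRel_of_reflTransGen {V : Type*} {r : V → V → Prop} {x y : V}
    (h : ReflTransGen r x y) : (SimpleGraph.fromRel r).Reachable x y := by
  induction h with
  | refl => rfl
  | @tail b c _ hbc ih =>
    by_cases hne : b = c
    · exact hne ▸ ih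
    · exact ih.trans (SimpleGraph.Adj.reachable (by simp [hne, hbc]))

variable {α β : Type*} {G T : Graph α β} {n : ℕ} {v : Fin (n + 1) → α} {f g : Fin n → β}

/-- An edge that joins two vertices connected by other edges closes a cycle. -/
theorem exists_isCycleOn_of_isLink {F : Set β} {e : β} {x y : α} (he : T.IsLink e x y)
    (heF : e ∉ F) (h : ReflTransGen (T.restrict F).Adj x y) :
    ∃ (k : ℕ) (z : Fin (k + 1) → α) (b : Fin (k + 1) → β), T.IsCycleOn z b := by
  obtain ⟨w, hw⟩ := (reachable_fromRel_of_reflTransGen h).exists_isPath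
  have hstep : ∀ i : Fin w.length, ∃ b, b ∈ F ∧ T.IsLink b (w.getVert i) (w.getVert (i + 1)) := by
    intro i
    have := w.adj_getVert_succ i.2
    simp only [SimpleGraph.fromRel_adj] at this
    rcases this.2 with ⟨b, hb⟩ | ⟨b, hb⟩
    · exact ⟨b, hb.1, hb.2⟩
    · exact ⟨b, hb.1, hb.2.symm⟩
  choose b hbF hb using hstep
  have hinj : ∀ {i j : ℕ}, i ≤ w.length → j ≤ w.length → w.getVert i = w.getVert j → i = j :=
    fun hi hj hij => hw.getVert_injOn hi hj hij
  refine ⟨w.length, fun i => w.getVert i, Fin.snoc b e, ?_, ?_, ?_⟩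
  · intro i j hij
    exact Fin.ext (hinj (by omega) (by omega) hij)
  · rw [Fin.snoc_injective_iff]
    refine ⟨fun i j hij => ?_, ?_⟩
    · have hi := hb i
      rw [hij] at hi
      rcases hi.eq_and_eq_or_eq_and_eq (hb j) with h | h
      · exact Fin.ext (hinj (by omega) (by omega) h.1)
      -- An edge traversed in both directions would force `i = j + 1` and `j = i + 1`.
      · have h1 := hinj (by omega) (by omega) h.1
        have h2 := hinj (by omega) (by omega) h.2
        omega
    · rintro ⟨i, rfl⟩
      exact heF (hbF i)
  · intro i
    induction i using Fin.lastCases with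
    | last => simpa using he.symm
    | cast i => simpa using hb i

/-- In a tree, a spanning connected set of edges is the whole edge set. -/
theorem IsTreeGraph.restrict_eq_self (hT : T.IsTreeGraph) {F : Set β}
    (hF : (T.restrict F).IsConnectedGraph) : T.restrict F = T := by
  rw [restrict_eq_self_iff]
  intro e he
  by_contra heF
  obtain ⟨x, y, hxy⟩ := T.exists_isLink_of_mem_edgeSet he
  obtain ⟨k, z, b, hc⟩ :=
    exists_isCycleOn_of_isLink hxy heF (hF.2 x hxy.left_mem y hxy.right_mem)
  exact hT.2 k z b hc

/-- `f` assigns to each vertex but the last an edge leading to a vertex of smaller height. -/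
def IsRootedChoice (G : Graph α β) (v : Fin (n + 1) → α) (f : Fin n → β) : Prop :=
  ∃ d : Fin (n + 1) → ℕ, ∀ i : Fin n, ∃ j,
    G.IsLink (f i) (v i.castSucc) (v j) ∧ d j < d i.castSucc

theorem IsRootedChoice.isConnectedGraph (hf : G.IsRootedChoice v f)
    (hv : Set.range v = G.vertexSet) : (G.restrict (Set.range f)).IsConnectedGraph := by
  obtain ⟨d, hd⟩ := hf
  have key : ∀ (m : ℕ) (i : Fin (n + 1)), d i = m →
      ReflTransGen (G.restrict (Set.range f)).Adj (v i) (v (Fin.last n)) := by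
    intro m
    induction m using Nat.strong_induction_on with
    | _ m ih =>
      intro i hi
      induction i using Fin.lastCases with
      | last => exact .refl
      | cast i =>
        obtain ⟨j, hj, hlt⟩ := hd i
        exact .head ⟨f i, ⟨i, rfl⟩, hj⟩ (ih _ (hi ▸ hlt) j rfl)
  refine ⟨⟨v (Fin.last n), ?_⟩, ?_⟩
  · change _ ∈ G.vertexSet
    exact hv ▸ Set.mem_range_self _
  · change ∀ x ∈ G.vertexSet, ∀ y ∈ G.vertexSet, _
    rw [← hv]
    rintro _ ⟨i, rfl⟩ _ ⟨j, rfl⟩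
    exact (key _ i rfl).trans (ReflTransGen.stdSymm.symm _ _ (key _ j rfl))

theorem IsRootedChoice.not_isCycleOn [G.Loopless] (hf : G.IsRootedChoice v f)
    (hinj : Function.Injective v) (hv : Set.range v = G.vertexSet) {k : ℕ}
    (x : Fin (k + 1) → α) (e : Fin (k + 1) → β) :
    ¬ (G.restrict (Set.range f)).IsCycleOn x e := by
  rintro ⟨-, he, hl⟩
  obtain ⟨d, hd⟩ := hf
  have hx : ∀ i, ∃ j, v j = x i := fun i => by
    have : x i ∈ G.vertexSet := (hl i).2.left_mem
    rwa [← hv] at this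
  choose a ha using hx
  obtain ⟨i, hi⟩ := Finite.exists_max fun i => d (a i)
  -- At a vertex of maximal height every cycle edge is the one chosen there.
  have key : ∀ b l, (G.restrict (Set.range f)).IsLink b (x i) (x l) →
      ∃ c : Fin n, c.castSucc = a i ∧ b = f c := by
    rintro b l ⟨⟨c, rfl⟩, hb⟩
    obtain ⟨j, hj, hlt⟩ := hd c
    rw [← ha, ← ha] at hb
    rcases hj.eq_and_eq_or_eq_and_eq hb with ⟨h, -⟩ | ⟨h, h'⟩
    · exact ⟨c, hinj h, rfl⟩
    · rw [hinj h, hinj h'] at hlt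
      exact absurd (hi l) (not_le.mpr hlt)
  obtain ⟨c, hc, hce⟩ := key _ _ (hl i)
  have hprev := hl (i - 1)
  rw [sub_add_cancel] at hprev
  obtain ⟨c', hc', hce'⟩ := key _ _ hprev.symm
  obtain rfl : c = c' := Fin.castSucc_injective _ (hc.trans hc'.symm)
  -- Both cycle edges at the top vertex are its chosen edge, so the cycle is a loop.
  have h1 : i - 1 = i := he (hce'.trans hce.symm)
  rw [h1] at hprev
  exact G.not_isLoopAt _ _ hprev.2

theorem IsRootedChoice.restrict_mem_spanningTrees [G.Loopless] (hf : G.IsRootedChoice v f)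
    (hinj : Function.Injective v) (hv : Set.range v = G.vertexSet) :
    G.restrict (Set.range f) ∈ G.spanningTrees :=
  ⟨⟨restrict_le, rfl⟩, hf.isConnectedGraph hv, fun _ x e => hf.not_isCycleOn hinj hv x e⟩

/-- Two rooted choices with the same edges agree: the vertices where they differ would form a set
closed under moving towards the root. -/
theorem IsRootedChoice.eq_of_range_eq (hf : G.IsRootedChoice v f)
    (hg : G.IsRootedChoice v g) (hinj : Function.Injective v)
    (h : Set.range f = Set.range g) : f = g := by
  obtain ⟨d, hd⟩ := hf
  obtain ⟨d', hd'⟩ := hg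
  have key : ∀ (m : ℕ) (i : Fin n), d i.castSucc = m → f i = g i := by
    intro m
    induction m using Nat.strong_induction_on with
    | _ m ih =>
      intro i hi
      by_contra hne
      obtain ⟨j, hj⟩ : f i ∈ Set.range g := h ▸ Set.mem_range_self i
      obtain ⟨a, ha, hlt⟩ := hd i
      obtain ⟨b, hb, -⟩ := hd' j
      rw [hj] at hb
      rcases ha.eq_and_eq_or_eq_and_eq hb with ⟨h1, -⟩ | ⟨h1, h2⟩
      · rw [Fin.castSucc_injective _ (hinj h1)] at hne
        rw [Fin.castSucc_injective _ (hinj h1)] at hj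
        exact hne hj.symm
      · rw [hinj h2] at hlt ha
        have hfj := ih _ (hi ▸ hlt) j rfl
        obtain ⟨c, hc, hlt'⟩ := hd j
        rw [hfj, hj] at hc
        rw [hinj (hc.right_unique ha.symm)] at hlt'
        exact lt_asymm hlt hlt'
  exact funext fun i => key _ i rfl

/-- Every spanning tree comes from a rooted choice: take at each vertex an edge that decreases the
distance to the last vertex. -/
theorem exists_isRootedChoice_of_mem_spanningTrees (hT : T ∈ G.spanningTrees)
    (hinj : Function.Injective v) (hv : Set.range v = G.vertexSet) :
    ∃ f, G.IsRootedChoice v f ∧ G.restrict (Set.range f) = T := by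
  obtain ⟨hTG, hT⟩ := hT
  have hvT : Set.range v = T.vertexSet := hv.trans hTG.vertexSet_eq.symm
  let S : SimpleGraph α := SimpleGraph.fromRel T.Adj
  have hmem : ∀ i, v i ∈ T.vertexSet := fun i => hvT ▸ Set.mem_range_self i
  have hstep : ∀ i : Fin n, ∃ b j, T.IsLink b (v i.castSucc) (v j) ∧
      S.dist (v j) (v (Fin.last n)) < S.dist (v i.castSucc) (v (Fin.last n)) := by
    intro i
    obtain ⟨w, hw⟩ := (reachable_fromRel_of_reflTransGen (hT.1.2 _ (hmem i.castSucc) _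
      (hmem (Fin.last n)))).exists_walk_length_eq_dist
    rw [← hw]
    have hne : v i.castSucc ≠ v (Fin.last n) := fun h => (Fin.castSucc_lt_last i).ne (hinj h)
    revert hne w
    generalize v (Fin.last n) = z
    rintro w - hne
    cases w with
    | nil => exact absurd rfl hne
    | @cons _ y _ hadj w =>
      have hy : T.Adj (v i.castSucc) y := by
        simp only [SimpleGraph.fromRel_adj] at hadj
        exact hadj.2.elim id Adj.symm
      obtain ⟨b, hb⟩ := hy
      obtain ⟨j, rfl⟩ : y ∈ Set.range v := hvT ▸ hb.right_mem
      exact ⟨b, j, hb, Nat.lt_succ_of_le (SimpleGraph.dist_le w)⟩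
  choose f j hf hlt using hstep
  have hfT : T.IsRootedChoice v f :=
    ⟨fun i => S.dist (v i) (v (Fin.last n)), fun i => ⟨j i, hf i, hlt i⟩⟩
  refine ⟨f, ⟨fun i => S.dist (v i) (v (Fin.last n)),
    fun i => ⟨j i, (hf i).mono hTG.le, hlt i⟩⟩, ?_⟩
  -- The chosen edges already connect `T`, so they are all of its edges.
  have hTf := hT.restrict_eq_self (hfT.isConnectedGraph hvT)
  refine Eq.trans ?_ hTf
  refine Graph.ext hTG.vertexSet_eq.symm fun e x y => ?_
  simp only [restrict_isLink]
  refine and_congr_right ?_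
  rintro ⟨i, rfl⟩
  exact (hTG.le.isLink_iff (hf i).edge_mem).symm

theorem numSpanningTrees_eq_ncard_isRootedChoice [G.Loopless]
    (hinj : Function.Injective v) (hv : Set.range v = G.vertexSet) :
    G.numSpanningTrees = {f | G.IsRootedChoice v f}.ncard := by
  have himg : G.spanningTrees =
      (fun f => G.restrict (Set.range f)) '' {f | G.IsRootedChoice v f} := by
    ext T
    constructor
    · exact fun hT => exists_isRootedChoice_of_mem_spanningTrees hT hinj hv
    · rintro ⟨f, hf, rfl⟩
      exact IsRootedChoice.restrict_mem_spanningTrees hf hinj hv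
  rw [numSpanningTrees, himg]
  refine Set.InjOn.ncard_image fun f hf g hg hfg => ?_
  refine IsRootedChoice.eq_of_range_eq hf hg hinj ?_
  have hE : G.edgeSet ∩ Set.range f = G.edgeSet ∩ Set.range g := congrArg Graph.edgeSet hfg
  have hsub : ∀ {f}, G.IsRootedChoice v f → Set.range f ⊆ G.edgeSet := by
    rintro f ⟨d, hd⟩ _ ⟨i, rfl⟩
    exact (hd i).choose_spec.1.edge_mem
  rwa [Set.inter_eq_self_of_subset_right (hsub hf),
    Set.inter_eq_self_of_subset_right (hsub hg)] at hE

open Classical in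
/-- The contribution of the edge `e` to row `i` of the Kirchhoff minor. -/
noncomputable def edgeRow (G : Graph α β) (v : Fin (n + 1) → α) (i : Fin n) (e : β) :
    Fin n → ℤ :=
  fun j => (if G.Inc e (v i.castSucc) then if i = j then 1 else 0 else 0) -
    if G.IsLink e (v i.castSucc) (v j.castSucc) then 1 else 0

theorem kirchhoffMinor_eq_sum_edgeRow [G.Loopless] (hE : G.edgeSet.Finite) :
    G.kirchhoffMinor v = fun i => ∑ e ∈ hE.toFinset, G.edgeRow v i e := by
  classical
  have hcard : ∀ (P : β → Prop), (∀ e, P e → e ∈ G.edgeSet) →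
      ({e | P e}.ncard : ℤ) = ∑ e ∈ hE.toFinset, if P e then 1 else 0 := by
    intro P hP
    rw [Finset.sum_boole, ← Set.ncard_coe_finset]
    congr 2
    ext e
    simpa using hP e
  ext i j
  have hloop : G.loopSet (v i.castSucc) = ∅ := by
    ext e; simp [loopSet]
  simp only [kirchhoffMinor, laplacianMatrix, adjacencyMatrix, Matrix.submatrix_apply, Matrix.sub_apply, Matrix.of_apply,
    Finset.sum_apply, edgeRow, Finset.sum_sub_distrib]
  rw [hcard _ fun e he => IsLink.edge_mem he]
  congr 1
  by_cases hij : i = j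
  · subst hij
    simp only [Matrix.diagonal_apply_eq, vertexDegree, hloop, Set.ncard_empty, add_zero, if_true]
    exact hcard (fun e => G.Inc e (v i.castSucc)) fun e he => Inc.edge_mem he
  · simp [hij]

-- An edge not incident to its vertex gives a zero row; otherwise the matrix is `1 - P`.
open Classical in
theorem det_edgeRow (hinj : Function.Injective v) (hv : Set.range v = G.vertexSet)
    (f : Fin n → β) :
    Matrix.det (fun i => G.edgeRow v i (f i)) = if G.IsRootedChoice v f then 1 else 0 := by
  by_cases hinc : ∀ i : Fin n, ∃ j, G.IsLink (f i) (v i.castSucc) (v j)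
  · choose p hp using hinc
    have hM : (fun i => G.edgeRow v i (f i)) = Matrix.of fun i j : Fin n =>
        (if i = j then (1 : ℤ) else 0) - if p i = j.castSucc then 1 else 0 := by
      ext i j
      simp [edgeRow, (hp i).inc_left, (hp i).isLink_iff_eq, hinj.eq_iff, eq_comm]
    have hiff : G.IsRootedChoice v f ↔
        ∃ d : Fin (n + 1) → ℕ, ∀ i, d (p i) < d i.castSucc := by
      refine exists_congr fun d => forall_congr' fun i => ⟨?_, fun h => ⟨p i, hp i, h⟩⟩
      rintro ⟨j, hj, hlt⟩
      rwa [hinj ((hp i).right_unique hj)]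
    rw [hM]
    split_ifs with h
    · obtain ⟨d, hd⟩ := hiff.mp h
      exact Matrix.det_one_sub_of_height p d hd
    · exact Matrix.det_one_sub_of_no_height p (mt hiff.mpr h)
  · have hf : ¬ G.IsRootedChoice v f := fun ⟨d, hd⟩ =>
      hinc fun i => ⟨(hd i).choose, (hd i).choose_spec.1⟩
    rw [if_neg hf]
    push Not at hinc
    obtain ⟨i, hi⟩ := hinc
    have hI : ¬ G.Inc (f i) (v i.castSucc) := by
      rintro ⟨y, hy⟩
      obtain ⟨j, rfl⟩ : y ∈ Set.range v := hv ▸ hy.right_mem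
      exact hi j hy
    exact Matrix.det_eq_zero_of_row_eq_zero i fun j => by simp [edgeRow, hI, hi]

/-- The matrix-tree theorem for a loopless multigraph with vertices listed by `v`. -/
theorem numSpanningTrees_eq_det_kirchhoffMinor [G.Loopless] (hE : G.edgeSet.Finite)
    (hinj : Function.Injective v) (hv : Set.range v = G.vertexSet) :
    (G.numSpanningTrees : ℤ) = (G.kirchhoffMinor v).det := by
  classical
  rw [kirchhoffMinor_eq_sum_edgeRow hE]
  have hdet := (Matrix.detRowAlternating (R := ℤ) (n := Fin n)).toMultilinearMap.map_sum_finset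
    (fun i e => G.edgeRow v i e) (fun _ => hE.toFinset)
  refine Eq.trans ?_ hdet.symm
  refine Eq.trans ?_ (Finset.sum_congr rfl fun f _ => (det_edgeRow hinj hv f).symm)
  rw [Finset.sum_boole, numSpanningTrees_eq_ncard_isRootedChoice hinj hv,
    ← Set.ncard_coe_finset]
  congr 2
  ext f
  simp only [Set.mem_ofPred_eq, Finset.coe_filter, Fintype.mem_piFinset, Set.Finite.mem_toFinset]
  -- Restricting to edges of `G` loses no rooted choice.
  refine ⟨fun hf => ⟨fun i => ?_, hf⟩, And.right⟩
  obtain ⟨d, hd⟩ := hf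
  exact (hd i).choose_spec.1.edge_mem

end Graph

/-- `v` is an arbitrary numbering of the `n + 1` vertices of the loopless multigraph `G`. -/
theorem mainTheorem2 {α β : Type*} (G : Graph α β) (hE : G.edgeSet.Finite) (hG : G.Loopless)
    (n : ℕ) (v : Fin (n + 1) ≃ G.vertexSet) :
    (G.numSpanningTrees : ℤ) = (G.kirchhoffMinor fun i => (v i : α)).det := by
  refine Graph.numSpanningTrees_eq_det_kirchhoffMinor hE
    (Subtype.val_injective.comp v.injective) ?_
  ext x
  exact ⟨fun ⟨i, hi⟩ => hi ▸ (v i).2, fun hx => ⟨v.symm ⟨x, hx⟩, by simp⟩⟩
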